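/- Let $p$ be an odd prime. A group $G$ is called capable if there exists a group $K$ such that $G \cong K/Z(K)$, where $Z(K)$ is the center of $K$. Let $G_1$ and $G_2$ be two noncyclic finite $p$-groups, each nilpotent of class at most two and of exponent $p$. Then the direct sum (direct product) $G_1 \oplus G_2$ is capable if and only if both $G_1$ and $G_2$ are capable. -/

import Mathlib

universe u v

/-- A group `G` is capable if it is the central quotient `K ⧸ Z(K)` of some group `K`.
The group `K` may be infinite. Letting `K` range over the universe of `G` loses nothing: if
`G ≃* K ⧸ Z(K)`, the subgroup of `K` generated by a set of representatives of the cosets of `Z(K)`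
has the same central quotient, and its cardinality is at most `max #G ℵ₀`. -/
def IsCapable (G : Type u) [Group G] : Prop :=
  ∃ (K : Type u) (_ : Group K), Nonempty (G ≃* K ⧸ Subgroup.center K)

/-- `G` is nilpotent of class at most two. -/
def HasClassAtMostTwo (G : Type u) [Group G] : Prop :=
  ∃ _ : Group.IsNilpotent G, Group.nilpotencyClass G ≤ 2

/-! Capability is tested one element at a time: `G` is capable once each `x ≠ 1` has a noncentral
lift to some central extension. Products of capable groups are easily capable. Conversely, let `G₁ ×
G₂ ≅ K/Z(K)`, let `A`, `B` be the preimages of the factors, and take `x ≠ 1` in `G₁`. If `x` lies in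
the commutator subgroup, lift it into `⁅A, A⁆`, which commutes with `B` by the three subgroups
lemma; the lift is noncentral in `K = AB`, hence in `A`, a central extension of `G₁`. Otherwise the
abelianization is an `𝔽_p`-space of dimension at least two, and a product of two functionals is a
cocycle that detects `x`. -/

/-! ### Capability through noncentral lifts -/

open Subgroup in
/-- The element `x` is detected by a central extension: some central extension of `G` has a
noncentral element above `x`. -/
def IsNoncentrallyLiftable {G : Type u} [Group G] (x : G) : Prop :=
  ∃ (E : Type u) (_ : Group E) (φ : E →* G), Function.Surjective φ ∧ φ.ker ≤ center E ∧
    ∃ e, φ e = x ∧ e ∉ center E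

open Subgroup in
/-- A group is capable if every nontrivial element has a noncentral lift to a central extension:
the fibre product of these extensions has the group as its central quotient. -/
theorem isCapable_of_forall_isNoncentrallyLiftable {G : Type u} [Group G]
    (h : ∀ x : G, x ≠ 1 → IsNoncentrallyLiftable x) : IsCapable G := by
  have h' : ∀ x : {x : G // x ≠ 1}, IsNoncentrallyLiftable x.1 := fun x => h x.1 x.2
  choose E iE φ hφ hker e he hc using h'
  let P : Subgroup (G × ∀ x, E x) :=
    { carrier := {q | ∀ x, φ x (q.2 x) = q.1}
      mul_mem' := fun {a b} ha hb x => by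
        simp only [Set.mem_ofPred_eq] at ha hb
        simp [ha x, hb x]
      one_mem' := fun x => by simp
      inv_mem' := fun {a} ha x => by
        simp only [Set.mem_ofPred_eq] at ha
        simp [ha x] }
  let π : P →* G := (MonoidHom.fst _ _).comp P.subtype
  have hP : ∀ (q : P) (x), φ x (q.1.2 x) = π q := fun q x => q.2 x
  have lift : ∀ g : G, ∃ q : ∀ x, E x, ∀ x, φ x (q x) = g := fun g =>
    ⟨fun x => (hφ x g).choose, fun x => (hφ x g).choose_spec⟩
  have hπ : Function.Surjective π := fun g => by
    obtain ⟨q, hq⟩ := lift g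
    exact ⟨⟨(g, q), hq⟩, rfl⟩
  have hπker : π.ker = center P := by
    ext q
    rw [MonoidHom.mem_ker, mem_center_iff]
    constructor
    · intro hq r
      have hz : ∀ x, q.1.2 x ∈ center (E x) := fun x =>
        hker x (by rw [MonoidHom.mem_ker, hP, hq])
      have hq1 : q.1.1 = 1 := hq
      ext x
      · simp [hq1]
      · exact mem_center_iff.1 (hz x) _
    · intro hq
      by_contra hne
      let x : {x : G // x ≠ 1} := ⟨π q, hne⟩
      have hz : q.1.2 x ∈ center (E x) := by
        classical
        rw [mem_center_iff]
        intro a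
        -- Any `a` occurs as the coordinate at `x` of some element of `P`, so centrality in `P`
        -- passes to that coordinate.
        obtain ⟨r, hr⟩ := lift (φ x a)
        have hr' : ∀ y, φ y (Function.update r x a y) = φ x a := by
          intro y
          by_cases hy : y = x
          · subst hy; simp
          · simp [Function.update_of_ne hy, hr y]
        have := congrArg (fun t : P => t.1.2 x) (hq ⟨(φ x a, Function.update r x a), hr'⟩)
        simpa using this
      refine hc x ?_
      have hmem : e x * (q.1.2 x)⁻¹ ∈ center (E x) :=
        hker x (by rw [MonoidHom.mem_ker, map_mul, map_inv, hP, he]; simp [x])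
      simpa using mul_mem hmem hz
  exact ⟨P, inferInstance, ⟨(QuotientGroup.quotientKerEquivOfSurjective π hπ).symm.trans
    (QuotientGroup.quotientMulEquivOfEq hπker)⟩⟩

/-- For a countable group, the central extension that detects an element may live in any
universe. -/
theorem isNoncentrallyLiftable_of_extension {G : Type u} [Group G] [Countable G]
    {E : Type v} [Group E] (φ : E →* G) (hφ : Function.Surjective φ)
    (hker : φ.ker ≤ Subgroup.center E) {e e' : E} (hne : e' * e ≠ e * e') :
    IsNoncentrallyLiftable (φ e) := by
  -- Generators: `e`, `e'` and a section of `φ`. They keep surjectivity and the noncommuting pair,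
  -- and generate a countable group.
  let gen : Option (Option G) → E := fun o => o.elim e fun o => o.elim e' (Function.surjInv hφ)
  let L : Subgroup E := (FreeGroup.lift gen).range
  have hgen : ∀ o, gen o ∈ L := fun o => ⟨FreeGroup.of o, FreeGroup.lift_apply_of⟩
  have : Countable (FreeGroup (Option (Option G))) := by
    unfold FreeGroup
    infer_instance
  have : Countable L := Set.countable_range (FreeGroup.lift gen)
  have : Small.{u} L := Countable.toSmall L
  let ε : Shrink.{u} L ≃* L := Shrink.mulEquiv
  refine ⟨Shrink.{u} L, inferInstance, (φ.comp L.subtype).comp ε.toMonoidHom, ?_, ?_,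
    ε.symm ⟨e, hgen none⟩, by simp, ?_⟩
  · intro g
    refine ⟨ε.symm ⟨_, hgen (some (some g))⟩, ?_⟩
    simpa [gen] using Function.surjInv_eq hφ g
  · intro a ha
    have hz : ((ε a : L) : E) ∈ Subgroup.center E := hker ha
    rw [Subgroup.mem_center_iff]
    intro b
    apply ε.injective
    rw [map_mul, map_mul]
    exact Subtype.ext (Subgroup.mem_center_iff.1 hz _)
  · intro hz
    have := congrArg (fun t => ((ε t : L) : E))
      (Subgroup.mem_center_iff.1 hz (ε.symm ⟨e', hgen (some none)⟩))
    exact hne (by simpa using this)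

/-! ### Elements of the commutator subgroup -/

open Subgroup in
/-- In a central quotient that is a direct product, a nontrivial element of the commutator subgroup
of a factor has a noncentral lift. -/
theorem isNoncentrallyLiftable_of_mem_commutator {G₁ : Type u} {G₂ : Type v} [Group G₁] [Group G₂]
    [Countable G₁] (h : IsCapable (G₁ × G₂)) {x : G₁} (hx : x ≠ 1) (hx' : x ∈ commutator G₁) :
    IsNoncentrallyLiftable x := by
  obtain ⟨K, _, ⟨ε⟩⟩ := h
  let φ : K →* G₁ × G₂ := ε.symm.toMonoidHom.comp (QuotientGroup.mk' (center K))
  have hφ : Function.Surjective φ := ε.symm.surjective.comp (QuotientGroup.mk'_surjective _)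
  have hker : ∀ k, φ k = 1 ↔ k ∈ center K := fun k => by simp [φ]
  let A : Subgroup K := ((MonoidHom.snd G₁ G₂).comp φ).ker
  let B : Subgroup K := ((MonoidHom.fst G₁ G₂).comp φ).ker
  have hA : ∀ k, k ∈ A ↔ (φ k).2 = 1 := fun k => Iff.rfl
  have hB : ∀ k, k ∈ B ↔ (φ k).1 = 1 := fun k => Iff.rfl
  have hAB : ⁅A, B⁆ ≤ center K := by
    rw [commutator_le]
    intro a ha b hb
    rw [← hker, map_commutatorElement, commutatorElement_eq_one_iff_commute]
    rw [hA] at ha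
    rw [hB] at hb
    exact Prod.ext (by simp [hb]) (by simp [ha])
  have hAA : ⁅⁅A, A⁆, B⁆ = ⊥ := by
    have h1 : ⁅⁅A, B⁆, A⁆ = ⊥ := by
      rw [commutator_eq_bot_iff_le_centralizer]
      exact hAB.trans (center_le_centralizer _)
    have h2 : ⁅⁅B, A⁆, A⁆ = ⊥ := by rwa [commutator_comm B A]
    exact commutator_commutator_eq_bot_of_rotate h1 h2
  obtain ⟨k, hkAA, hk⟩ : (x, (1 : G₂)) ∈ (⁅A, A⁆).map φ := by
    have hmap : A.map φ = (⊤ : Subgroup G₁).map (MonoidHom.inl G₁ G₂) := by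
      ext ⟨g, g'⟩
      constructor
      · rintro ⟨k, hk, hkg⟩
        have : g' = 1 := by rw [← (hA k).1 hk, hkg]
        exact ⟨g, mem_top _, by simp [this]⟩
      · rintro ⟨a, -, ha⟩
        obtain ⟨k, hk⟩ := hφ (g, g')
        refine ⟨k, (hA k).2 ?_, hk⟩
        rw [hk, ← ha]
        simp
    rw [map_commutator, hmap, ← map_commutator]
    exact ⟨x, hx', rfl⟩
  have hkA : k ∈ A := by rw [hA, hk]
  have hknot : k ∉ center K := by
    rw [← hker, hk]
    intro h1
    exact hx (congrArg Prod.fst h1)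
  obtain ⟨a, ha⟩ : ∃ a : A, a * ⟨k, hkA⟩ ≠ ⟨k, hkA⟩ * a := by
    by_contra! hcomm
    apply hknot
    rw [mem_center_iff]
    intro m
    -- Split `m = m₁ * (m₁⁻¹ * m)` along `K = AB`.
    obtain ⟨m₁, hm₁⟩ := hφ ((φ m).1, 1)
    have hm₁A : m₁ ∈ A := by rw [hA, hm₁]
    have hm₂B : m₁⁻¹ * m ∈ B := by rw [hB]; simp [hm₁]
    have c₁ : Commute m₁ k := congrArg Subtype.val (hcomm ⟨m₁, hm₁A⟩)
    have c₂ : Commute (m₁⁻¹ * m) k :=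
      (mem_centralizer_iff.1 (commutator_eq_bot_iff_le_centralizer.1 hAA hkAA) _ hm₂B)
    have := c₁.mul_left c₂
    rwa [mul_inv_cancel_left] at this
  let ψ : A →* G₁ := ((MonoidHom.fst G₁ G₂).comp φ).comp A.subtype
  have hψk : ψ ⟨k, hkA⟩ = x := by simp [ψ, hk]
  rw [← hψk]
  refine isNoncentrallyLiftable_of_extension ψ (fun g => ?_) (fun b hb => ?_) ha
  · obtain ⟨b, hb⟩ := hφ (g, 1)
    exact ⟨⟨b, by rw [hA, hb]⟩, by simp [ψ, hb]⟩
  · have hz : b.1 ∈ center K := (hker _).1 (Prod.ext hb ((hA _).1 b.2))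
    exact mem_center_iff.2 fun c => Subtype.ext (mem_center_iff.1 hz c)

/-! ### Elements outside the commutator subgroup -/

/-- The central extension of `G` by `R` whose cocycle is the product of two homomorphisms from `G`
to the additive group of `R`. -/
@[ext]
structure BilinearExtension {G : Type u} {R : Type v} [Group G] [CommRing R]
    (f₁ f₂ : G →* Multiplicative R) where
  base : G
  fibre : R

namespace BilinearExtension

variable {G : Type u} {R : Type v} [Group G] [CommRing R] {f₁ f₂ : G →* Multiplicative R}

instance : Mul (BilinearExtension f₁ f₂) :=
  ⟨fun a b => ⟨a.base * b.base,
    a.fibre + b.fibre + (f₁ a.base).toAdd * (f₂ b.base).toAdd⟩⟩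

instance : One (BilinearExtension f₁ f₂) := ⟨⟨1, 0⟩⟩

instance : Inv (BilinearExtension f₁ f₂) :=
  ⟨fun a => ⟨a.base⁻¹, -a.fibre + (f₁ a.base).toAdd * (f₂ a.base).toAdd⟩⟩

@[simp] theorem base_mul (a b : BilinearExtension f₁ f₂) : (a * b).base = a.base * b.base := rfl

@[simp] theorem fibre_mul (a b : BilinearExtension f₁ f₂) :
    (a * b).fibre = a.fibre + b.fibre + (f₁ a.base).toAdd * (f₂ b.base).toAdd := rfl

@[simp] theorem base_one : (1 : BilinearExtension f₁ f₂).base = 1 := rfl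

@[simp] theorem fibre_one : (1 : BilinearExtension f₁ f₂).fibre = 0 := rfl

@[simp] theorem base_inv (a : BilinearExtension f₁ f₂) : a⁻¹.base = a.base⁻¹ := rfl

@[simp] theorem fibre_inv (a : BilinearExtension f₁ f₂) :
    a⁻¹.fibre = -a.fibre + (f₁ a.base).toAdd * (f₂ a.base).toAdd := rfl

instance : Group (BilinearExtension f₁ f₂) :=
  Group.ofLeftAxioms
    (fun a b c => by
      ext
      · simp [mul_assoc]
      · simp
        ring)
    (fun a => by ext <;> simp)
    (fun a => by
      ext
      · simp
      · simp)

/-- The projection of the extension onto its base. -/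
def proj : BilinearExtension f₁ f₂ →* G where
  toFun := base
  map_one' := rfl
  map_mul' _ _ := rfl

theorem proj_surjective : Function.Surjective (proj : BilinearExtension f₁ f₂ →* G) :=
  fun g => ⟨⟨g, 0⟩, rfl⟩

theorem ker_proj_le_center :
    (proj : BilinearExtension f₁ f₂ →* G).ker ≤ Subgroup.center (BilinearExtension f₁ f₂) := by
  intro a ha
  have ha' : a.base = 1 := ha
  rw [Subgroup.mem_center_iff]
  intro b
  ext
  · simp [ha']
  · simp [ha', add_comm]

end BilinearExtension

/-- A group whose commutator subgroup is central is cyclic as soon as its abelianization is. -/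
theorem isCyclic_of_isCyclic_abelianization {G : Type u} [Group G]
    (hG : commutator G ≤ Subgroup.center G) [IsCyclic (Abelianization G)] : IsCyclic G := by
  have hker : (Abelianization.of : G →* Abelianization G).ker = commutator G :=
    Abelianization.ker_of G
  -- A group that is cyclic modulo a central subgroup is abelian.
  have hcomm := (Abelianization.of : G →* _).isMulCommutative_of_isCyclic_of_ker_le_center
    (hker.trans_le hG)
  have hbot : commutator G = ⊥ := by
    rw [commutator_eq_bot_iff_center_eq_top, Subgroup.eq_top_iff']
    exact fun a => Subgroup.mem_center_iff.2 fun b => hcomm.is_comm.comm b a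
  refine isCyclic_of_injective (Abelianization.of : G →* _) ?_
  rw [← MonoidHom.ker_eq_bot_iff, hker, hbot]

theorem HasClassAtMostTwo.commutator_le_center {G : Type u} [Group G] (h : HasClassAtMostTwo G) :
    commutator G ≤ Subgroup.center G := by
  obtain ⟨_, hc⟩ := h
  have h2 : (⊤ : Subgroup G).lowerCentralSeries 2 = ⊥ :=
    Subgroup.lowerCentralSeries_eq_bot_iff_nilpotencyClass_le.2 hc
  rw [Subgroup.lowerCentralSeries_succ, Subgroup.top_lowerCentralSeries_one,
    Subgroup.commutator_eq_bot_iff_le_centralizer] at h2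
  rwa [Subgroup.coe_top, Subgroup.centralizer_univ] at h2

/-- A nonzero vector that does not span the space is separated from some other vector by a pair of
linear functionals. -/
theorem exists_dual_pair_of_span_ne_top {k : Type u} {V : Type v} [Field k] [AddCommGroup V]
    [Module k V] {v : V} (hv : v ≠ 0) (hspan : Submodule.span k {v} ≠ ⊤) :
    ∃ (l₁ l₂ : V →ₗ[k] k) (w : V), l₁ v ≠ 0 ∧ l₂ v = 0 ∧ l₂ w ≠ 0 := by
  obtain ⟨l₁, hl₁⟩ : ∃ l : V →ₗ[k] k, l v ≠ 0 := by
    by_contra! h0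
    exact hv ((Module.forall_dual_apply_eq_zero_iff k v).1 h0)
  obtain ⟨l₂, hl₂, hle⟩ := Submodule.exists_le_ker_of_lt_top _ hspan.lt_top
  obtain ⟨w, hw⟩ : ∃ w, l₂ w ≠ 0 := by
    by_contra! h0
    exact hl₂ (LinearMap.ext h0)
  exact ⟨l₁, l₂, w, hl₁, hle (Submodule.mem_span_singleton_self v), hw⟩

/-- Scalars in `ZMod p` come from integers, so the line through `v` is the cyclic subgroup it
generates. -/
theorem span_singleton_ne_top_of_not_isAddCyclic {p : ℕ} {V : Type u} [AddCommGroup V]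
    [Module (ZMod p) V] (hcyc : ¬ IsAddCyclic V) (v : V) : Submodule.span (ZMod p) {v} ≠ ⊤ := by
  intro htop
  refine hcyc ⟨v, fun y => ?_⟩
  have hy : y ∈ Submodule.span (ZMod p) {v} := htop ▸ Submodule.mem_top
  obtain ⟨c, hc⟩ := Submodule.mem_span_singleton.1 hy
  obtain ⟨n, rfl⟩ := ZMod.intCast_surjective c
  rw [Int.cast_smul_eq_zsmul] at hc
  exact ⟨n, hc⟩

/-- In a noncyclic additive group of prime exponent, every nonzero element is separated from some
other element by a pair of homomorphisms to the prime field. -/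
theorem exists_addMonoidHom_pair {p : ℕ} [Fact p.Prime] {V : Type u} [AddCommGroup V]
    (hV : ∀ v : V, p • v = 0) (hcyc : ¬ IsAddCyclic V) {v : V} (hv : v ≠ 0) :
    ∃ (l₁ l₂ : V →+ ZMod p) (w : V), l₁ v ≠ 0 ∧ l₂ v = 0 ∧ l₂ w ≠ 0 := by
  let _ : Module (ZMod p) V := AddCommGroup.zmodModule hV
  obtain ⟨l₁, l₂, w, h⟩ := exists_dual_pair_of_span_ne_top hv
    (span_singleton_ne_top_of_not_isAddCyclic (p := p) hcyc v)
  exact ⟨l₁.toAddMonoidHom, l₂.toAddMonoidHom, w, h⟩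

/-- In a noncyclic group of prime exponent with central commutator subgroup, the elements outside
the commutator subgroup have noncentral lifts. -/
theorem isNoncentrallyLiftable_of_notMem_commutator {p : ℕ} [Fact p.Prime] {G : Type u} [Group G]
    [Countable G] (hexp : ∀ g : G, g ^ p = 1) (hcyc : ¬ IsCyclic G)
    (hG : commutator G ≤ Subgroup.center G) {x : G} (hx : x ∉ commutator G) :
    IsNoncentrallyLiftable x := by
  have hof : Function.Surjective (Abelianization.of : G →* Abelianization G) :=
    QuotientGroup.mk_surjective
  have hV : ∀ v : Additive (Abelianization G), p • v = 0 := fun v => by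
    obtain ⟨g, hg⟩ := hof v.toMul
    have : v.toMul ^ p = 1 := by rw [← hg, ← map_pow, hexp, map_one]
    exact this
  have hv : Additive.ofMul (Abelianization.of x) ≠ 0 := fun h0 => hx <| by
    rw [← Abelianization.ker_of G]
    exact h0
  have hcyc' : ¬ IsAddCyclic (Additive (Abelianization G)) := fun h => hcyc <|
    have := isAddCyclic_additive_iff.1 h
    isCyclic_of_isCyclic_abelianization hG
  obtain ⟨l₁, l₂, w, h₁, h₂, hw⟩ := exists_addMonoidHom_pair hV hcyc' hv
  obtain ⟨y, hy⟩ := hof w.toMul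
  let f : (Additive (Abelianization G) →+ ZMod p) → G →* Multiplicative (ZMod p) := fun l =>
    (AddMonoidHom.toMultiplicativeRight l).comp Abelianization.of
  have hfx : ∀ l, (f l x).toAdd = l (Additive.ofMul (Abelianization.of x)) := fun l => rfl
  have hfy : ∀ l, (f l y).toAdd = l w := fun l => congrArg (fun t => l (Additive.ofMul t)) hy
  refine isNoncentrallyLiftable_of_extension
    (BilinearExtension.proj : BilinearExtension (f l₁) (f l₂) →* G)
    BilinearExtension.proj_surjective BilinearExtension.ker_proj_le_center
    (e := ⟨x, 0⟩) (e' := ⟨y, 0⟩) fun hcomm => ?_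
  -- The fibres of the two products are `l₁ w * l₂ v = 0` and `l₁ v * l₂ w ≠ 0`.
  have := congrArg BilinearExtension.fibre hcomm
  simp [hfx, hfy, h₂, h₁, hw] at this

/-! ### Capability of direct products -/

theorem IsCapable.of_prod_left {p : ℕ} [Fact p.Prime] {G₁ : Type u} {G₂ : Type v} [Group G₁]
    [Group G₂] [Countable G₁] (hexp : ∀ g : G₁, g ^ p = 1) (hcyc : ¬ IsCyclic G₁)
    (hclass : HasClassAtMostTwo G₁) (h : IsCapable (G₁ × G₂)) : IsCapable G₁ := by
  refine isCapable_of_forall_isNoncentrallyLiftable fun x hx => ?_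
  by_cases hx' : x ∈ commutator G₁
  · exact isNoncentrallyLiftable_of_mem_commutator h hx hx'
  · exact isNoncentrallyLiftable_of_notMem_commutator hexp hcyc hclass.commutator_le_center hx'

theorem IsCapable.congr {G H : Type u} [Group G] [Group H] (ε : G ≃* H) (h : IsCapable G) :
    IsCapable H := by
  obtain ⟨K, i, ⟨δ⟩⟩ := h
  exact ⟨K, i, ⟨ε.symm.trans δ⟩⟩

/-- The center of a product is the product of the centers. -/
theorem IsCapable.prod {G₁ : Type u} {G₂ : Type v} [Group G₁] [Group G₂] (h₁ : IsCapable G₁)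
    (h₂ : IsCapable G₂) : IsCapable (G₁ × G₂) := by
  obtain ⟨K₁, _, ⟨ε₁⟩⟩ := h₁
  obtain ⟨K₂, _, ⟨ε₂⟩⟩ := h₂
  let φ : K₁ × K₂ →* G₁ × G₂ :=
    (ε₁.symm.toMonoidHom.comp (QuotientGroup.mk' (Subgroup.center K₁))).prodMap
      (ε₂.symm.toMonoidHom.comp (QuotientGroup.mk' (Subgroup.center K₂)))
  have hφ : Function.Surjective φ := Function.Surjective.prodMap
    (ε₁.symm.surjective.comp (QuotientGroup.mk'_surjective _))
    (ε₂.symm.surjective.comp (QuotientGroup.mk'_surjective _))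
  have hker : φ.ker = Subgroup.center (K₁ × K₂) := by
    ext ⟨a, b⟩
    simp only [MonoidHom.mem_ker, φ, MonoidHom.prodMap_def, MonoidHom.prod_apply, Prod.mk_eq_one,
      Subgroup.mem_center_iff]
    simp only [MonoidHom.coe_comp, Function.comp_apply, MonoidHom.coe_fst, MonoidHom.coe_snd,
      QuotientGroup.mk'_apply, MulEquiv.toMonoidHom_eq_coe, MonoidHom.coe_coe,
      EmbeddingLike.map_eq_one_iff, QuotientGroup.eq_one_iff, Subgroup.mem_center_iff,
      Prod.forall, Prod.mk_mul_mk, Prod.mk.injEq]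
    exact ⟨fun h c d => ⟨h.1 c, h.2 d⟩, fun h => ⟨fun c => (h c 1).1, fun d => (h 1 d).2⟩⟩
  exact ⟨K₁ × K₂, inferInstance, ⟨(QuotientGroup.quotientKerEquivOfSurjective φ hφ).symm.trans
    (QuotientGroup.quotientMulEquivOfEq hker)⟩⟩

theorem mainTheorem11 (p : ℕ) (hp : p.Prime) (hp_odd : Odd p)
    (G₁ : Type u) (G₂ : Type v) [Group G₁] [Group G₂] [Finite G₁] [Finite G₂]
    (hG₁ : IsPGroup p G₁) (hG₂ : IsPGroup p G₂)
    (hcyc₁ : ¬ IsCyclic G₁) (hcyc₂ : ¬ IsCyclic G₂)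
    (hclass₁ : HasClassAtMostTwo G₁) (hclass₂ : HasClassAtMostTwo G₂)
    (hexp₁ : Monoid.exponent G₁ = p) (hexp₂ : Monoid.exponent G₂ = p) :
    IsCapable (G₁ × G₂) ↔ IsCapable G₁ ∧ IsCapable G₂ := by
  have : Fact p.Prime := ⟨hp⟩
  have h₁ : ∀ g : G₁, g ^ p = 1 := fun g => hexp₁ ▸ Monoid.pow_exponent_eq_one g
  have h₂ : ∀ g : G₂, g ^ p = 1 := fun g => hexp₂ ▸ Monoid.pow_exponent_eq_one g
  exact ⟨fun h => ⟨h.of_prod_left h₁ hcyc₁ hclass₁,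
    (h.congr MulEquiv.prodComm).of_prod_left h₂ hcyc₂ hclass₂⟩, fun h => h.1.prod h.2⟩
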